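/- For a nonnegative integer $n$ let $H_n=\sum_{j=1}^{n}\frac1j$ denote the $n$-th harmonic number (so $H_0=0$). Then both of the following series converge (absolutely), with the values $$\sum_{k=1}^{\infty}\frac{(-1)^{k-1}}{k^3\binom{2k}{k}\binom{3k}{k}}\left(\frac{56k^2-32k+5}{(2k-1)^2}\,H_{2k-1}+\frac{1}{2k}\right)=\frac{\pi^4}{20}$$ and $$\sum_{k=1}^{\infty}\frac{(-1)^k\left((56k^2-32k+5)\left(H_{3k-1}-\frac{46}{3}H_{2k-1}-H_{k-1}\right)-12k\right)}{(2k-1)^2\,k^3\binom{2k}{k}\binom{3k}{k}}=\frac{7\pi^4}{10}.$$ -/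

import Mathlib

open Filter Topology Finset

/-! Both series come from one discrete closed form on the lattice: `wzF` and `wzG` satisfy ΔₘF = ΔₖG
(`wz_closed`), with weights linear in three free parameters x, y, z. Summing it along the axis k = 0
or along a staircase of slope 1/2 gives results that differ only by a boundary sum of `wzF`
(`sum_wzStep`), which tends to 0 (`tendsto_sum_wzF`). On the axis the terms involve only Hₘ/(m+1)³
and 1/(m+1)⁴, so Euler's ∑ Hₘ/(m+1)³ = ζ(4)/4 makes the total (3x − 6y − 3z) ζ(4). On the staircase,
each step is n!³/(3n+1)! times a harmonic expression, and two choices of (x, y, z) turn it into the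
two summands. -/

/-- The harmonic numbers as real numbers. -/
noncomputable def realHarmonic (n : ℕ) : ℝ := ((harmonic n : ℚ) : ℝ)

lemma realHarmonic_zero : realHarmonic 0 = 0 := by simp [realHarmonic]

lemma realHarmonic_succ (n : ℕ) : realHarmonic (n + 1) = realHarmonic n + 1 / ((n : ℝ) + 1) := by
  simp [realHarmonic, harmonic_succ]

lemma realHarmonic_eq_sum (n : ℕ) : realHarmonic n = ∑ i ∈ range n, 1 / ((i : ℝ) + 1) := by
  simp [realHarmonic, harmonic]

lemma realHarmonic_mono : Monotone realHarmonic :=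
  monotone_nat_of_le_succ fun n => by
    rw [realHarmonic_succ]
    have : (0 : ℝ) ≤ 1 / ((n : ℝ) + 1) := by positivity
    linarith

lemma realHarmonic_nonneg (n : ℕ) : 0 ≤ realHarmonic n := by
  rw [← realHarmonic_zero]; exact realHarmonic_mono (Nat.zero_le n)

lemma one_le_realHarmonic_succ (n : ℕ) : 1 ≤ realHarmonic (n + 1) := by
  have h : realHarmonic 1 = 1 := by simpa [realHarmonic_zero] using realHarmonic_succ 0
  rw [← h]; exact realHarmonic_mono (by omega)

lemma realHarmonic_le (n : ℕ) : realHarmonic n ≤ n := by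
  induction n with
  | zero => simp [realHarmonic_zero]
  | succ n ih =>
    rw [realHarmonic_succ]
    have : 1 / ((n : ℝ) + 1) ≤ 1 := by
      rw [div_le_one (by positivity)]; linarith [(Nat.cast_nonneg n : (0 : ℝ) ≤ n)]
    push_cast; linarith

lemma tendsto_realHarmonic_div :
    Tendsto (fun n : ℕ => realHarmonic n / (n : ℝ)) atTop (𝓝 0) := by
  have h := (tendsto_one_div_add_atTop_nhds_zero_nat (𝕜 := ℝ)).cesaro
  refine h.congr fun n => ?_
  rw [realHarmonic_eq_sum, div_eq_inv_mul]

/-! ### Euler's evaluation of `∑ H_{n-1} / n ^ 3` -/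

lemma hasSum_one_div_succ_sq :
    HasSum (fun n : ℕ => 1 / ((n : ℝ) + 1) ^ 2) (Real.pi ^ 2 / 6) := by
  have h := (hasSum_nat_add_iff' 1).2 hasSum_zeta_two
  simpa using h

lemma hasSum_one_div_succ_pow_four :
    HasSum (fun n : ℕ => 1 / ((n : ℝ) + 1) ^ 4) (Real.pi ^ 4 / 90) := by
  have h := (hasSum_nat_add_iff' 1).2 hasSum_zeta_four
  simpa using h

lemma sum_range_sq_eq (a : ℕ → ℝ) (N : ℕ) :
    (∑ i ∈ range N, a i) ^ 2 =
      2 * ∑ n ∈ range N, a n * ∑ i ∈ range n, a i + ∑ i ∈ range N, a i ^ 2 := by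
  induction N with
  | zero => simp
  | succ N ih => simp only [sum_range_succ]; linear_combination ih

lemma hasSum_zeta_two_two :
    HasSum (fun n : ℕ => 1 / ((n : ℝ) + 1) ^ 2 * ∑ i ∈ range n, 1 / ((i : ℝ) + 1) ^ 2)
      (((Real.pi ^ 2 / 6) ^ 2 - Real.pi ^ 4 / 90) / 2) := by
  rw [hasSum_iff_tendsto_nat_of_nonneg
    (fun n => mul_nonneg (by positivity) (sum_nonneg fun i _ => by positivity))]
  have h := ((hasSum_one_div_succ_sq.tendsto_sum_nat.pow 2).sub
    hasSum_one_div_succ_pow_four.tendsto_sum_nat).div_const 2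
  refine h.congr fun N => ?_
  rw [sum_range_sq_eq]
  have : ∑ i ∈ range N, (1 / ((i : ℝ) + 1) ^ 2) ^ 2 = ∑ i ∈ range N, 1 / ((i : ℝ) + 1) ^ 4 :=
    sum_congr rfl fun i _ => by rw [div_pow, ← pow_mul, one_pow]
  rw [this]; ring

lemma sum_antidiagonal_one_div_sq (n : ℕ) :
    ∑ p ∈ antidiagonal n, 1 / ((p.1 : ℝ) + 1) ^ 2 * (1 / ((p.2 : ℝ) + 1) ^ 2) =
      2 * (1 / ((n : ℝ) + 2) ^ 2 * ∑ i ∈ range (n + 1), 1 / ((i : ℝ) + 1) ^ 2) +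
        4 * (realHarmonic (n + 1) / ((n : ℝ) + 2) ^ 3) := by
  -- Partial fractions: with a + b = n + 2, square 1/(ab) = (1/a + 1/b)/(a + b), then apply the same
  -- identity to the cross term.
  have hterm : ∀ p ∈ antidiagonal n, 1 / ((p.1 : ℝ) + 1) ^ 2 * (1 / ((p.2 : ℝ) + 1) ^ 2) =
      (1 / ((n : ℝ) + 2) ^ 2 * (1 / ((p.1 : ℝ) + 1) ^ 2) +
        2 / ((n : ℝ) + 2) ^ 3 * (1 / ((p.1 : ℝ) + 1))) +
      (1 / ((n : ℝ) + 2) ^ 2 * (1 / ((p.2 : ℝ) + 1) ^ 2) +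
        2 / ((n : ℝ) + 2) ^ 3 * (1 / ((p.2 : ℝ) + 1))) := by
    rintro ⟨i, j⟩ hp
    have hn : (n : ℝ) = i + j := by rw [← mem_antidiagonal.1 hp]; push_cast; rfl
    have h1 : (i : ℝ) + 1 ≠ 0 := by positivity
    have h2 : (j : ℝ) + 1 ≠ 0 := by positivity
    have h3 : (i : ℝ) + j + 2 ≠ 0 := by positivity
    simp only [hn]
    field_simp
    ring
  rw [sum_congr rfl hterm, sum_add_distrib,
    Nat.sum_antidiagonal_eq_sum_range_succ_mk, Nat.sum_antidiagonal_eq_sum_range_succ_mk]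
  have hrefl := sum_range_reflect (fun i : ℕ => 1 / ((n : ℝ) + 2) ^ 2 * (1 / ((i : ℝ) + 1) ^ 2) +
        2 / ((n : ℝ) + 2) ^ 3 * (1 / ((i : ℝ) + 1))) (n + 1)
  simp only [Nat.add_sub_cancel] at hrefl
  simp only [Nat.succ_eq_add_one]
  rw [hrefl, sum_add_distrib, ← mul_sum, ← mul_sum, realHarmonic_eq_sum]
  ring

/-- Two expansions of ζ(2)² are compared: the Cauchy product gives 2ζ(2,2) + 4ζ(3,1), ordering the
indices gives 2ζ(2,2) + ζ(4). Hence ζ(3,1) = ζ(4)/4. -/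
lemma hasSum_realHarmonic_div_succ_cube :
    HasSum (fun n : ℕ => realHarmonic n / ((n : ℝ) + 1) ^ 3) (Real.pi ^ 4 / 360) := by
  have hs : Summable fun n : ℕ => ‖1 / ((n : ℝ) + 1) ^ 2‖ := hasSum_one_div_succ_sq.summable.norm
  have hprod : HasSum (fun n : ℕ => ∑ p ∈ antidiagonal (n : ℕ),
      1 / ((p.1 : ℝ) + 1) ^ 2 * (1 / ((p.2 : ℝ) + 1) ^ 2)) ((Real.pi ^ 2 / 6) ^ 2) := by
    have h1 := tsum_mul_tsum_eq_tsum_sum_antidiagonal_of_summable_norm hs hs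
    rw [hasSum_one_div_succ_sq.tsum_eq, ← sq] at h1
    rw [h1]
    exact (summable_norm_sum_mul_antidiagonal_of_summable_norm hs hs).of_norm.hasSum
  -- The antidiagonal of n matches index n + 1 of the double sums, whose terms at index 0 vanish.
  have h22 := (hasSum_nat_add_iff' 1).2 hasSum_zeta_two_two
  have hval : Real.pi ^ 4 / 360 - ∑ i ∈ range 1, realHarmonic i / ((i : ℝ) + 1) ^ 3 =
      ((Real.pi ^ 2 / 6) ^ 2 - 2 * (((Real.pi ^ 2 / 6) ^ 2 - Real.pi ^ 4 / 90) / 2 -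
        ∑ i ∈ range 1, 1 / ((i : ℝ) + 1) ^ 2 * ∑ j ∈ range i, 1 / ((j : ℝ) + 1) ^ 2)) / 4 := by
    simp only [range_one, sum_singleton, range_zero, sum_empty, realHarmonic_zero]
    ring
  rw [← hasSum_nat_add_iff' 1, hval]
  refine (congrArg (HasSum · _) (funext fun n => ?_)).mpr
    ((hprod.sub (h22.mul_left 2)).div_const 4)
  rw [sum_antidiagonal_one_div_sq]
  push_cast
  ring

/-! ### A Wilf–Zeilberger pair with harmonic weights -/

/-- The component in the direction of `k` of the closed form. The coefficients `x`, `y`, `z` are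
those of the logarithmic derivatives in the three parameters of the underlying hypergeometric
pair. -/
noncomputable def wzF (x y z : ℝ) (m k : ℕ) : ℝ :=
  (-1) ^ k * (k.factorial : ℝ) ^ 2 * ((m - k - 1).factorial : ℝ) /
      (((m + k + 1).factorial : ℝ) * ((k : ℝ) + 1)) *
    (x * (2 * realHarmonic m + 1 / ((k : ℝ) + 1)) +
      y * (realHarmonic (m - k - 1) - realHarmonic (m + k + 1)) +
      z * (2 * realHarmonic k - realHarmonic (m - k - 1) - realHarmonic (m + k + 1) -
        1 / ((k : ℝ) + 1)))

/-- The component in the direction of `m` of the closed form. -/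
noncomputable def wzG (x y z : ℝ) (m k : ℕ) : ℝ :=
  2 * (-1) ^ k * (k.factorial : ℝ) ^ 2 * ((m - k).factorial : ℝ) /
      (((m + k + 1).factorial : ℝ) * ((m : ℝ) + 1) ^ 2) *
    (x * (2 * realHarmonic m + 1 / ((m : ℝ) + 1)) +
      y * (realHarmonic (m - k) - realHarmonic (m + k + 1) - 2 / ((m : ℝ) + 1)) +
      z * (2 * realHarmonic k - realHarmonic (m - k) - realHarmonic (m + k + 1)))

lemma wz_closed (x y z : ℝ) {m k : ℕ} (hkm : k < m) :
    wzF x y z (m + 1) k - wzF x y z m k = wzG x y z m (k + 1) - wzG x y z m k := by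
  -- This removes truncated subtraction. Once all factorials and harmonic numbers are reduced to
  -- common ones, a rational identity with those as indeterminates remains.
  obtain ⟨d, rfl⟩ : ∃ d, m = k + 1 + d := ⟨m - (k + 1), by omega⟩
  have e1 : k + 1 + d + 1 - k - 1 = d + 1 := by omega
  have e2 : k + 1 + d - k - 1 = d := by omega
  have e3 : k + 1 + d - (k + 1) = d := by omega
  have e4 : k + 1 + d - k = d + 1 := by omega
  have e5 : k + 1 + d + 1 + k + 1 = (k + 1 + d + k + 1) + 1 := by omega
  have e6 : k + 1 + d + (k + 1) + 1 = (k + 1 + d + k + 1) + 1 := by omega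
  have hN : ((k + 1 + d + k + 1).factorial : ℝ) ≠ 0 := by positivity
  simp only [wzF, wzG, e1, e3, e4, e5, e6, Nat.factorial_succ (k + 1 + d + k + 1),
    Nat.factorial_succ d, Nat.factorial_succ k,
    realHarmonic_succ (k + 1 + d + k + 1), realHarmonic_succ d, realHarmonic_succ k,
    realHarmonic_succ (k + 1 + d)]
  generalize ((k + 1 + d + k + 1).factorial : ℕ) = N at hN ⊢
  generalize realHarmonic (k + 1 + d + k + 1) = h₁
  generalize realHarmonic (k + 1 + d) = h₂
  push_cast
  have q1 : (k : ℝ) + 1 ≠ 0 := by positivity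
  have q2 : (d : ℝ) + 1 ≠ 0 := by positivity
  have q3 : (k : ℝ) + 1 + d + 1 ≠ 0 := by positivity
  have q4 : (k : ℝ) + 1 + d + k + 1 + 1 ≠ 0 := by positivity
  field_simp
  ring

/-- The sum of the closed form along the staircase step from `(2n, n)` to `(2n + 2, n + 1)`. -/
noncomputable def wzStep (x y z : ℝ) (n : ℕ) : ℝ :=
  wzG x y z (2 * n) n + wzG x y z (2 * n + 1) n + wzF x y z (2 * n + 2) n

lemma sum_wzStep (x y z : ℝ) (N : ℕ) :
    ∑ n ∈ range N, wzStep x y z n =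
      ∑ m ∈ range (2 * N), wzG x y z m 0 + ∑ k ∈ range N, wzF x y z (2 * N) k := by
  induction N with
  | zero => simp
  | succ N ih =>
    -- Moving the boundary row from 2N to 2N + 2 uses the closed form in two rows; the right side
    -- telescopes in k.
    have hF : ∑ k ∈ range N, wzF x y z (2 * N + 2) k - ∑ k ∈ range N, wzF x y z (2 * N) k =
        (wzG x y z (2 * N) N + wzG x y z (2 * N + 1) N) -
          (wzG x y z (2 * N) 0 + wzG x y z (2 * N + 1) 0) := by
      rw [← sum_sub_distrib,
        ← sum_range_sub (fun k => wzG x y z (2 * N) k + wzG x y z (2 * N + 1) k) N]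
      refine sum_congr rfl fun k hk => ?_
      have hk' := mem_range.1 hk
      have h1 := wz_closed x y z (show k < 2 * N by omega)
      have h2 := wz_closed x y z (show k < 2 * N + 1 by omega)
      linear_combination h1 + h2
    rw [sum_range_succ, ih, show 2 * (N + 1) = 2 * N + 1 + 1 by ring, sum_range_succ,
      sum_range_succ, sum_range_succ (fun k => wzF x y z (2 * N + 1 + 1) k), wzStep]
    linear_combination -hF

lemma hasSum_wzG_zero (x y z : ℝ) :
    HasSum (fun m => wzG x y z m 0) ((3 * x - 6 * y - 3 * z) * (Real.pi ^ 4 / 90)) := by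
  have h := (hasSum_realHarmonic_div_succ_cube.mul_left (4 * (x - z))).add
    (hasSum_one_div_succ_pow_four.mul_left (2 * x - 6 * y - 2 * z))
  have hval : (3 * x - 6 * y - 3 * z) * (Real.pi ^ 4 / 90) =
      4 * (x - z) * (Real.pi ^ 4 / 360) + (2 * x - 6 * y - 2 * z) * (Real.pi ^ 4 / 90) := by ring
  rw [hval]
  refine (congrArg (HasSum · _) (funext fun m => ?_)).mpr h
  have hm : (m.factorial : ℝ) ≠ 0 := by positivity
  have q : (m : ℝ) + 1 ≠ 0 := by positivity
  simp only [wzG, Nat.sub_zero, Nat.add_zero, Nat.factorial_succ, realHarmonic_succ,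
    realHarmonic_zero, Nat.factorial_zero]
  push_cast
  field_simp
  ring

/-! ### Bounds -/

/-- The binomials C(m, k) and C(m+k+1, k) are at least 1. -/
lemma factorial_quotient_le {m k : ℕ} (hkm : k ≤ m) :
    (k.factorial : ℝ) ^ 2 * ((m - k).factorial : ℝ) / ((m + k + 1).factorial : ℝ) ≤
      1 / ((m : ℝ) + 1) := by
  have h1 : k.factorial * (m - k).factorial ≤ m.factorial :=
    Nat.le_of_dvd (Nat.factorial_pos _) (Nat.factorial_mul_factorial_dvd_factorial hkm)
  have h2 : (m + 1).factorial * k.factorial ≤ (m + k + 1).factorial := by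
    have := Nat.le_of_dvd (Nat.factorial_pos _) (Nat.factorial_mul_factorial_dvd_factorial_add (m + 1) k)
    rwa [show m + 1 + k = m + k + 1 by ring] at this
  rw [div_le_div_iff₀ (by positivity) (by positivity)]
  have h3 : k.factorial ^ 2 * (m - k).factorial * (m + 1) ≤ 1 * (m + k + 1).factorial := by
    calc k.factorial ^ 2 * (m - k).factorial * (m + 1)
        = (k.factorial * (m - k).factorial) * ((m + 1) * k.factorial) := by ring
      _ ≤ m.factorial * ((m + 1) * k.factorial) := Nat.mul_le_mul_right _ h1
      _ = (m + 1).factorial * k.factorial := by rw [Nat.factorial_succ]; ring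
      _ ≤ 1 * (m + k + 1).factorial := by rwa [one_mul]
  exact_mod_cast h3

lemma factorial_quotient_le' {m k : ℕ} (hkm : k < m) :
    (k.factorial : ℝ) ^ 2 * ((m - k - 1).factorial : ℝ) / ((m + k + 1).factorial : ℝ) ≤
      1 / (m : ℝ) ^ 2 := by
  obtain ⟨p, rfl⟩ : ∃ p, m = p + 1 := ⟨m - 1, by omega⟩
  have e : p + 1 - k - 1 = p - k := by omega
  have e' : p + 1 + k + 1 = (p + k + 1) + 1 := by omega
  rw [e, e', Nat.factorial_succ]
  have h := factorial_quotient_le (show k ≤ p by omega)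
  push_cast
  calc (k.factorial : ℝ) ^ 2 * ((p - k).factorial : ℝ) /
        (((p : ℝ) + k + 1 + 1) * ((p + k + 1).factorial : ℝ))
      = (k.factorial : ℝ) ^ 2 * ((p - k).factorial : ℝ) / ((p + k + 1).factorial : ℝ) *
          (1 / ((p : ℝ) + k + 1 + 1)) := by field_simp
    _ ≤ 1 / ((p : ℝ) + 1) * (1 / ((p : ℝ) + 1)) := by
        refine mul_le_mul h ?_ (by positivity) (by positivity)
        exact one_div_le_one_div_of_le (by positivity) (by
          linarith [(Nat.cast_nonneg k : (0 : ℝ) ≤ k)])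
    _ = 1 / ((p : ℝ) + 1) ^ 2 := by field_simp

lemma abs_weight_le {x y z a b c H : ℝ} (ha : |a| ≤ 4 * H) (hb : |b| ≤ 4 * H) (hc : |c| ≤ 4 * H) :
    |x * a + y * b + z * c| ≤ 4 * (|x| + |y| + |z|) * H := by
  have h1 := mul_le_mul_of_nonneg_left ha (abs_nonneg x)
  have h2 := mul_le_mul_of_nonneg_left hb (abs_nonneg y)
  have h3 := mul_le_mul_of_nonneg_left hc (abs_nonneg z)
  have h4 := abs_add_three (x * a) (y * b) (z * c)
  rw [abs_mul, abs_mul, abs_mul] at h4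
  linarith

lemma one_div_succ_mem (n : ℕ) : 0 ≤ 1 / ((n : ℝ) + 1) ∧ 1 / ((n : ℝ) + 1) ≤ 1 :=
  ⟨by positivity, by
    rw [div_le_one (by positivity)]; linarith [(Nat.cast_nonneg n : (0 : ℝ) ≤ n)]⟩

lemma abs_wzF_le (x y z : ℝ) {m k : ℕ} (hkm : k < m) :
    |wzF x y z m k| ≤
      4 * (|x| + |y| + |z|) * realHarmonic (m + k + 1) / ((m : ℝ) ^ 2 * ((k : ℝ) + 1)) := by
  have hw := fun a b c => @abs_weight_le x y z a b c (realHarmonic (m + k + 1))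
  have hm := realHarmonic_mono (show m ≤ m + k + 1 by omega)
  have hk := realHarmonic_mono (show k ≤ m + k + 1 by omega)
  have hmk := realHarmonic_mono (show m - k - 1 ≤ m + k + 1 by omega)
  -- Since the largest harmonic number is at least 1, it also absorbs the rational terms of the
  -- weights.
  have h1 := one_le_realHarmonic_succ (m + k)
  have n1 := realHarmonic_nonneg m
  have n2 := realHarmonic_nonneg k
  have n3 := realHarmonic_nonneg (m - k - 1)
  have hd := one_div_succ_mem k
  rw [wzF, abs_mul, abs_div, abs_mul, abs_mul, abs_pow, abs_neg, abs_one, one_pow, one_mul,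
    abs_of_nonneg (show (0 : ℝ) ≤ (k.factorial : ℝ) ^ 2 by positivity),
    abs_of_nonneg (show (0 : ℝ) ≤ ((m - k - 1).factorial : ℝ) by positivity),
    abs_of_nonneg (show (0 : ℝ) ≤ ((m + k + 1).factorial : ℝ) * ((k : ℝ) + 1) by positivity),
    ← div_div]
  have hm0 : (0 : ℝ) < m := by exact_mod_cast (by omega : 0 < m)
  calc _ ≤ 1 / (m : ℝ) ^ 2 / ((k : ℝ) + 1) *
        (4 * (|x| + |y| + |z|) * realHarmonic (m + k + 1)) := by
        refine mul_le_mul (div_le_div_of_nonneg_right (factorial_quotient_le' hkm) (by positivity))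
          (hw _ _ _ ?_ ?_ ?_) (abs_nonneg _) (by positivity)
        all_goals rw [abs_le]; constructor <;> linarith
    _ = _ := by field_simp

lemma abs_wzG_le (x y z : ℝ) {m k : ℕ} (hkm : k ≤ m) :
    |wzG x y z m k| ≤
      8 * (|x| + |y| + |z|) * realHarmonic (m + k + 1) / ((m : ℝ) + 1) ^ 3 := by
  have hw := fun a b c => @abs_weight_le x y z a b c (realHarmonic (m + k + 1))
  have hm := realHarmonic_mono (show m ≤ m + k + 1 by omega)
  have hk := realHarmonic_mono (show k ≤ m + k + 1 by omega)
  have hmk := realHarmonic_mono (show m - k ≤ m + k + 1 by omega)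
  have h1 := one_le_realHarmonic_succ (m + k)
  have n1 := realHarmonic_nonneg m
  have n2 := realHarmonic_nonneg k
  have n3 := realHarmonic_nonneg (m - k)
  have hd := one_div_succ_mem m
  have hd2 : 2 / ((m : ℝ) + 1) = 2 * (1 / ((m : ℝ) + 1)) := by ring
  rw [wzG, abs_mul, abs_div, abs_mul, abs_mul, abs_mul, abs_pow, abs_neg, abs_one, one_pow,
    mul_one, abs_of_nonneg (show (0 : ℝ) ≤ (k.factorial : ℝ) ^ 2 by positivity),
    abs_of_nonneg (show (0 : ℝ) ≤ ((m - k).factorial : ℝ) by positivity),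
    abs_of_nonneg (show (0 : ℝ) ≤ ((m + k + 1).factorial : ℝ) * ((m : ℝ) + 1) ^ 2 by positivity),
    abs_two, ← div_div, mul_assoc 2, mul_div_assoc 2]
  calc _ ≤ 2 * (1 / ((m : ℝ) + 1)) / ((m : ℝ) + 1) ^ 2 *
        (4 * (|x| + |y| + |z|) * realHarmonic (m + k + 1)) := by
        refine mul_le_mul (div_le_div_of_nonneg_right
          (mul_le_mul_of_nonneg_left (factorial_quotient_le hkm) zero_le_two) (by positivity))
          (hw _ _ _ ?_ ?_ ?_) (abs_nonneg _) (by positivity)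
        all_goals rw [abs_le]; constructor <;> linarith
    _ = _ := by field_simp; ring

lemma tendsto_sum_wzF (x y z : ℝ) :
    Tendsto (fun N => ∑ k ∈ range N, wzF x y z (2 * N) k) atTop (𝓝 0) := by
  have h3 : Tendsto (fun N : ℕ => realHarmonic (3 * N) / ((3 * N : ℕ) : ℝ)) atTop (𝓝 0) :=
    tendsto_realHarmonic_div.comp (tendsto_id.const_mul_atTop' (by norm_num : 0 < 3))
  -- The 3 arises from 4 H₃ₙ Hₙ/(2n)² = 3 (H₃ₙ/(3n)) (Hₙ/n), with n = N.
  have hlim := (h3.mul tendsto_realHarmonic_div).const_mul (3 * (|x| + |y| + |z|))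
  simp only [mul_zero] at hlim
  refine squeeze_zero_norm (fun N => ?_) hlim
  rw [Real.norm_eq_abs]
  rcases Nat.eq_zero_or_pos N with rfl | hN
  · simp
  have hN0 : (0 : ℝ) < N := by exact_mod_cast hN
  calc |∑ k ∈ range N, wzF x y z (2 * N) k|
      ≤ ∑ k ∈ range N, |wzF x y z (2 * N) k| := abs_sum_le_sum_abs _ _
    _ ≤ ∑ k ∈ range N, (4 * (|x| + |y| + |z|) * realHarmonic (3 * N) / (2 * (N : ℝ)) ^ 2) *
          (1 / ((k : ℝ) + 1)) := by
        refine sum_le_sum fun k hk => ?_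
        have hk' := mem_range.1 hk
        refine (abs_wzF_le x y z (show k < 2 * N by omega)).trans ?_
        rw [div_mul_div_comm, mul_one]
        push_cast
        have := realHarmonic_mono (show 2 * N + k + 1 ≤ 3 * N by omega)
        gcongr
    _ = _ := by
        rw [← mul_sum, ← realHarmonic_eq_sum]
        push_cast
        field_simp
        ring

lemma summable_wzStep (x y z : ℝ) : Summable (wzStep x y z) := by
  set B := |x| + |y| + |z| with hB
  have hB0 : 0 ≤ B := by positivity
  have hs : Summable fun n : ℕ => 100 * B * (1 / ((n : ℝ) + 1) ^ 2) :=
    hasSum_one_div_succ_sq.summable.mul_left _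
  refine Summable.of_norm_bounded hs fun n => ?_
  rw [Real.norm_eq_abs, wzStep]
  have hn : (0 : ℝ) ≤ n := Nat.cast_nonneg n
  have hG : ∀ m, n ≤ m → m ≤ 2 * n + 1 → |wzG x y z m n| ≤ 32 * B * (1 / ((n : ℝ) + 1) ^ 2) := by
    intro m h1 h2
    refine (abs_wzG_le x y z h1).trans ?_
    -- The crude bound Hⱼ ≤ j suffices: the cubic denominator still leaves 1/(n+1)².
    have h3 : realHarmonic (m + n + 1) ≤ 4 * ((n : ℝ) + 1) := by
      refine (realHarmonic_le _).trans ?_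
      exact_mod_cast (by omega : m + n + 1 ≤ 4 * (n + 1))
    have h4 : (n : ℝ) + 1 ≤ (m : ℝ) + 1 := by exact_mod_cast (by omega : n + 1 ≤ m + 1)
    calc 8 * B * realHarmonic (m + n + 1) / ((m : ℝ) + 1) ^ 3
        ≤ 8 * B * (4 * ((n : ℝ) + 1)) / ((n : ℝ) + 1) ^ 3 := by gcongr
      _ = _ := by field_simp; ring
  have hF : |wzF x y z (2 * n + 2) n| ≤ 16 * B * (1 / ((n : ℝ) + 1) ^ 2) := by
    refine (abs_wzF_le x y z (show n < 2 * n + 2 by omega)).trans ?_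
    have h3 : realHarmonic (2 * n + 2 + n + 1) ≤ 4 * ((n : ℝ) + 1) := by
      refine (realHarmonic_le _).trans ?_
      exact_mod_cast (by omega : 2 * n + 2 + n + 1 ≤ 4 * (n + 1))
    calc 4 * B * realHarmonic (2 * n + 2 + n + 1) / (((2 * n + 2 : ℕ) : ℝ) ^ 2 * ((n : ℝ) + 1))
        ≤ 4 * B * (4 * ((n : ℝ) + 1)) / (((n : ℝ) + 1) ^ 2 * ((n : ℝ) + 1)) := by
          gcongr
          push_cast; linarith
      _ = _ := by field_simp; ring
  have h1 := hG (2 * n) (by omega) (by omega)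
  have h2 := hG (2 * n + 1) (by omega) (by omega)
  have h3 := abs_add_three (wzG x y z (2 * n) n) (wzG x y z (2 * n + 1) n)
    (wzF x y z (2 * n + 2) n)
  have h4 : 0 ≤ B * (1 / ((n : ℝ) + 1) ^ 2) := by positivity
  linarith

/-- Summability reduces the claim to partial sums, where the axis sum runs to 2N and the boundary
sum vanishes in the limit. -/
lemma hasSum_wzStep (x y z : ℝ) :
    HasSum (wzStep x y z) ((3 * x - 6 * y - 3 * z) * (Real.pi ^ 4 / 90)) := by
  rw [(summable_wzStep x y z).hasSum_iff_tendsto_nat]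
  have h1 := (hasSum_wzG_zero x y z).tendsto_sum_nat.comp
    (tendsto_id.const_mul_atTop' (by norm_num : 0 < 2))
  have h2 := h1.add (tendsto_sum_wzF x y z)
  rw [add_zero] at h2
  exact h2.congr fun N => (sum_wzStep x y z N).symm

/-! ### Closed form of the staircase step -/

lemma choose_two_mul_succ (n : ℕ) :
    (Nat.choose (2 * (n + 1)) (n + 1) : ℝ) =
      ((2 * n + 2).factorial : ℝ) / (((n + 1).factorial : ℝ) * ((n + 1).factorial : ℝ)) := by
  rw [Nat.cast_choose ℝ (by omega), show 2 * (n + 1) - (n + 1) = n + 1 by omega,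
    show 2 * (n + 1) = 2 * n + 2 by ring]

lemma choose_three_mul_succ (n : ℕ) :
    (Nat.choose (3 * (n + 1)) (n + 1) : ℝ) =
      ((3 * n + 3).factorial : ℝ) / (((n + 1).factorial : ℝ) * ((2 * n + 2).factorial : ℝ)) := by
  rw [Nat.cast_choose ℝ (by omega), show 3 * (n + 1) - (n + 1) = 2 * n + 2 by omega,
    show 3 * (n + 1) = 3 * n + 3 by ring]

/-- Common closed form: everything is a multiple of `n! ^ 3 / (3 n + 1)!`. -/
lemma wzStep_eq (x y z : ℝ) (n : ℕ) :
    wzStep x y z n =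
      (-1) ^ n * (n.factorial : ℝ) ^ 3 / ((3 * n + 1).factorial : ℝ) *
      (2 / (2 * (n : ℝ) + 1) ^ 2 *
        (x * (2 * realHarmonic (2 * n) + 1 / (2 * (n : ℝ) + 1)) +
          y * (realHarmonic n - realHarmonic (3 * n + 1) - 2 / (2 * (n : ℝ) + 1)) +
          z * (realHarmonic n - realHarmonic (3 * n + 1))) +
       1 / (2 * ((n : ℝ) + 1) * (3 * (n : ℝ) + 2)) *
        (x * (2 * realHarmonic (2 * n) + 2 / (2 * (n : ℝ) + 1) + 1 / (2 * (n : ℝ) + 2)) +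
          y * (realHarmonic n + 1 / ((n : ℝ) + 1) - realHarmonic (3 * n + 1) -
            1 / (3 * (n : ℝ) + 2) - 2 / (2 * (n : ℝ) + 2)) +
          z * (realHarmonic n - 1 / ((n : ℝ) + 1) - realHarmonic (3 * n + 1) -
            1 / (3 * (n : ℝ) + 2))) +
       1 / ((3 * (n : ℝ) + 2) * (3 * (n : ℝ) + 3)) *
        (x * (2 * realHarmonic (2 * n) + 2 / (2 * (n : ℝ) + 1) + 2 / (2 * (n : ℝ) + 2) +
            1 / ((n : ℝ) + 1)) +
          y * (realHarmonic n + 1 / ((n : ℝ) + 1) - realHarmonic (3 * n + 1) -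
            1 / (3 * (n : ℝ) + 2) - 1 / (3 * (n : ℝ) + 3)) +
          z * (realHarmonic n - 2 / ((n : ℝ) + 1) - realHarmonic (3 * n + 1) -
            1 / (3 * (n : ℝ) + 2) - 1 / (3 * (n : ℝ) + 3)))) := by
  have e1 : 2 * n - n = n := by omega
  have e2 : 2 * n + 1 - n = n + 1 := by omega
  have e3 : 2 * n + 2 - n - 1 = n + 1 := by omega
  have e4 : 2 * n + n + 1 = 3 * n + 1 := by omega
  have e5 : 2 * n + 1 + n + 1 = 3 * n + 1 + 1 := by omega
  have e6 : 2 * n + 2 + n + 1 = 3 * n + 1 + 1 + 1 := by omega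
  have e7 : 2 * n + 2 = 2 * n + 1 + 1 := by omega
  have hN : ((3 * n + 1).factorial : ℝ) ≠ 0 := by positivity
  rw [wzStep, wzG, wzG, wzF, e1, e2, e3, e4, e5, e6, e7]
  simp only [Nat.factorial_succ (3 * n + 1), Nat.factorial_succ (3 * n + 1 + 1),
    Nat.factorial_succ n, realHarmonic_succ (3 * n + 1), realHarmonic_succ (3 * n + 1 + 1),
    realHarmonic_succ n, realHarmonic_succ (2 * n), realHarmonic_succ (2 * n + 1)]
  generalize ((3 * n + 1).factorial : ℕ) = N at hN ⊢
  generalize realHarmonic (3 * n + 1) = h₁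
  generalize realHarmonic (2 * n) = h₂
  generalize realHarmonic n = h₃
  generalize (-1 : ℝ) ^ n = s
  push_cast
  have q1 : (n : ℝ) + 1 ≠ 0 := by positivity
  have q2 : 2 * (n : ℝ) + 1 ≠ 0 := by positivity
  have q3 : 3 * (n : ℝ) + 2 ≠ 0 := by positivity
  have r1 : 2 * (n : ℝ) + 1 + 1 = 2 * ((n : ℝ) + 1) := by ring
  have r2 : 3 * (n : ℝ) + 1 + 1 = 3 * (n : ℝ) + 2 := by ring
  have r3 : 3 * (n : ℝ) + 2 + 1 = 3 * ((n : ℝ) + 1) := by ring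
  have r4 : 2 * (n : ℝ) + 2 = 2 * ((n : ℝ) + 1) := by ring
  have r5 : 3 * (n : ℝ) + 3 = 3 * ((n : ℝ) + 1) := by ring
  simp only [r1, r2, r3, r4, r5]
  field_simp
  ring

/-! ### Matching the staircase steps with the two summands -/

lemma cube_mul_choose_mul_choose (n : ℕ) :
    ((n : ℝ) + 1) ^ 3 * (Nat.choose (2 * (n + 1)) (n + 1) : ℝ) *
        (Nat.choose (3 * (n + 1)) (n + 1) : ℝ) =
      3 * ((n : ℝ) + 1) * (3 * (n : ℝ) + 2) * ((3 * n + 1).factorial : ℝ) /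
        (n.factorial : ℝ) ^ 3 := by
  rw [choose_two_mul_succ, choose_three_mul_succ, show 3 * n + 3 = 3 * n + 1 + 1 + 1 by ring,
    Nat.factorial_succ (3 * n + 1 + 1), Nat.factorial_succ (3 * n + 1), Nat.factorial_succ n]
  push_cast
  field_simp
  ring

lemma first_term_eq (n : ℕ) :
    (-1 : ℝ) ^ n / (((n : ℝ) + 1) ^ 3 * (Nat.choose (2 * (n + 1)) (n + 1) : ℝ) *
        (Nat.choose (3 * (n + 1)) (n + 1) : ℝ)) *
      ((56 * ((n : ℝ) + 1) ^ 2 - 32 * ((n : ℝ) + 1) + 5) / (2 * ((n : ℝ) + 1) - 1) ^ 2 *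
          realHarmonic (2 * n + 1) + 1 / (2 * ((n : ℝ) + 1))) =
      wzStep 1 (-1 / 2) (1 / 2) n := by
  rw [wzStep_eq, cube_mul_choose_mul_choose, realHarmonic_succ (2 * n)]
  push_cast
  have q1 : (n : ℝ) + 1 ≠ 0 := by positivity
  have q2 : 2 * (n : ℝ) + 1 ≠ 0 := by positivity
  have q3 : 3 * (n : ℝ) + 2 ≠ 0 := by positivity
  have r3 : 2 * ((n : ℝ) + 1) - 1 = 2 * (n : ℝ) + 1 := by ring
  have r4 : 2 * (n : ℝ) + 2 = 2 * ((n : ℝ) + 1) := by ring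
  have r5 : 3 * (n : ℝ) + 3 = 3 * ((n : ℝ) + 1) := by ring
  simp only [r3, r4, r5]
  field_simp
  ring

lemma second_term_eq (n : ℕ) :
    (-1 : ℝ) ^ (n + 1) *
        ((56 * ((n : ℝ) + 1) ^ 2 - 32 * ((n : ℝ) + 1) + 5) *
            (realHarmonic (3 * n + 2) - 46 / 3 * realHarmonic (2 * n + 1) - realHarmonic n) -
          12 * ((n : ℝ) + 1)) /
      ((2 * ((n : ℝ) + 1) - 1) ^ 2 * ((n : ℝ) + 1) ^ 3 *
        (Nat.choose (2 * (n + 1)) (n + 1) : ℝ) * (Nat.choose (3 * (n + 1)) (n + 1) : ℝ)) =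
      wzStep (46 / 3) (-23 / 3) (29 / 3) n := by
  rw [wzStep_eq, mul_assoc (_ ^ 2), mul_assoc (_ ^ 2), cube_mul_choose_mul_choose,
    realHarmonic_succ (2 * n), show 3 * n + 2 = 3 * n + 1 + 1 by ring,
    realHarmonic_succ (3 * n + 1), pow_succ]
  push_cast
  have q1 : (n : ℝ) + 1 ≠ 0 := by positivity
  have q2 : 2 * (n : ℝ) + 1 ≠ 0 := by positivity
  have q3 : 3 * (n : ℝ) + 2 ≠ 0 := by positivity
  have r2 : 3 * (n : ℝ) + 1 + 1 = 3 * (n : ℝ) + 2 := by ring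
  have r3 : 2 * ((n : ℝ) + 1) - 1 = 2 * (n : ℝ) + 1 := by ring
  have r4 : 2 * (n : ℝ) + 2 = 2 * ((n : ℝ) + 1) := by ring
  have r5 : 3 * (n : ℝ) + 3 = 3 * ((n : ℝ) + 1) := by ring
  simp only [r2, r3, r4, r5]
  field_simp
  ring

lemma hasSum_subtype_one_le_iff {f : ℕ → ℝ} {s : ℝ} :
    HasSum (fun k : {n : ℕ // 1 ≤ n} => f k) s ↔ HasSum (fun n : ℕ => f (n + 1)) s := by
  let e : ℕ ≃ {n : ℕ // 1 ≤ n} :=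
    { toFun := fun n => ⟨n + 1, by omega⟩
      invFun := fun k => (k : ℕ) - 1
      left_inv := fun n => by simp
      right_inv := fun k => Subtype.ext (Nat.sub_add_cancel k.2) }
  exact (e.hasSum_iff (f := fun k : {n : ℕ // 1 ≤ n} => f k)).symm

theorem theorem1p6 :
    HasSum
      (fun k : {n : ℕ // 1 ≤ n} =>
        (-1 : ℝ) ^ ((k : ℕ) - 1) /
            (((k : ℕ) : ℝ) ^ 3 * (Nat.choose (2 * (k : ℕ)) (k : ℕ) : ℝ) *
              (Nat.choose (3 * (k : ℕ)) (k : ℕ) : ℝ)) *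
          ((56 * ((k : ℕ) : ℝ) ^ 2 - 32 * ((k : ℕ) : ℝ) + 5) / (2 * ((k : ℕ) : ℝ) - 1) ^ 2 *
              ((harmonic (2 * (k : ℕ) - 1) : ℚ) : ℝ) +
            1 / (2 * ((k : ℕ) : ℝ))))
      (Real.pi ^ 4 / 20) ∧
    HasSum
      (fun k : {n : ℕ // 1 ≤ n} =>
        (-1 : ℝ) ^ (k : ℕ) *
            ((56 * ((k : ℕ) : ℝ) ^ 2 - 32 * ((k : ℕ) : ℝ) + 5) *
                (((harmonic (3 * (k : ℕ) - 1) : ℚ) : ℝ) -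
                  46 / 3 * ((harmonic (2 * (k : ℕ) - 1) : ℚ) : ℝ) -
                  ((harmonic ((k : ℕ) - 1) : ℚ) : ℝ)) -
              12 * ((k : ℕ) : ℝ)) /
          ((2 * ((k : ℕ) : ℝ) - 1) ^ 2 * ((k : ℕ) : ℝ) ^ 3 *
            (Nat.choose (2 * (k : ℕ)) (k : ℕ) : ℝ) * (Nat.choose (3 * (k : ℕ)) (k : ℕ) : ℝ)))
      (7 * Real.pi ^ 4 / 10) := by
  rw [hasSum_subtype_one_le_iff (f := fun k : ℕ => (-1 : ℝ) ^ (k - 1) /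
            ((k : ℝ) ^ 3 * (Nat.choose (2 * k) k : ℝ) * (Nat.choose (3 * k) k : ℝ)) *
          ((56 * (k : ℝ) ^ 2 - 32 * (k : ℝ) + 5) / (2 * (k : ℝ) - 1) ^ 2 *
              ((harmonic (2 * k - 1) : ℚ) : ℝ) + 1 / (2 * (k : ℝ)))),
    hasSum_subtype_one_le_iff (f := fun k : ℕ => (-1 : ℝ) ^ k *
            ((56 * (k : ℝ) ^ 2 - 32 * (k : ℝ) + 5) *
                (((harmonic (3 * k - 1) : ℚ) : ℝ) - 46 / 3 * ((harmonic (2 * k - 1) : ℚ) : ℝ) -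
                  ((harmonic (k - 1) : ℚ) : ℝ)) - 12 * (k : ℝ)) /
          ((2 * (k : ℝ) - 1) ^ 2 * (k : ℝ) ^ 3 * (Nat.choose (2 * k) k : ℝ) *
            (Nat.choose (3 * k) k : ℝ)))]
  have e2 : ∀ n : ℕ, 2 * (n + 1) - 1 = 2 * n + 1 := fun n => by omega
  have e3 : ∀ n : ℕ, 3 * (n + 1) - 1 = 3 * n + 2 := fun n => by omega
  constructor
  -- Matching H₂ₙ forces x = 1, and y + z = 0 cancels Hₙ − H₃ₙ₊₁; y − z adjusts the rational
  -- remainder.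
  · have h := hasSum_wzStep 1 (-1 / 2) (1 / 2)
    rw [show (3 * 1 - 6 * (-1 / 2) - 3 * (1 / 2)) * (Real.pi ^ 4 / 90) = Real.pi ^ 4 / 20 by
      ring] at h
    convert h using 2 with n
    rw [← first_term_eq, e2, Nat.add_sub_cancel, Nat.cast_succ]
    rfl
  -- Here x = 46/3 matches H₂ₙ, y + z = 2 matches Hₙ − H₃ₙ₊₁, and y − z again adjusts the rational
  -- part.
  · have h := hasSum_wzStep (46 / 3) (-23 / 3) (29 / 3)
    rw [show (3 * (46 / 3) - 6 * (-23 / 3) - 3 * (29 / 3)) * (Real.pi ^ 4 / 90) =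
      7 * Real.pi ^ 4 / 10 by ring] at h
    convert h using 2 with n
    rw [← second_term_eq, e2, e3, Nat.add_sub_cancel, Nat.cast_succ]
    rfl
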